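/- A subgroup $G\subseteq GL(n,\mathbb C)$ is called algebraic if it is the set of common zeros in $GL(n,\mathbb C)$ of a set of polynomials in the matrix entries; its Lie algebra is the set of matrices $X$ with $dP_1(X)=0$ for every polynomial $P$ in the ideal $I(G)$ of all polynomials vanishing on $G$ (where $dP_1$ is the differential of $P$ at the identity). A Lie subalgebra of $gl(n,\mathbb C)$ is called algebraic if it is the Lie algebra of an algebraic subgroup of $GL(n,\mathbb C)$. Let $\alpha,\beta\in\mathbb C$ with $\alpha+\beta\neq 0$, let $\mathfrak h\subset gl(4,\mathbb C)$ be the Lie subalgebra of all matrices $$X(x_1,x_2,x_3)=\begin{pmatrix} x_1+x_2 & x_1+x_2 & 0 & x_1\\ x_1+x_2 & x_1+x_2 & 0 & x_2\\ \alpha x_1+(\beta-1)x_2 & \beta x_1+(\alpha+1)x_2 & 0 & x_3\\ 0&0&0&0\end{pmatrix},\qquad x_1,x_2,x_3\in\mathbb C,$$ and let $$X_4=\begin{pmatrix} 1&1&0&\tfrac12\\ 1&1&0&\tfrac12\\ \tfrac{\alpha+\beta}2&\tfrac{\alpha+\beta}2&0&\tfrac{\alpha+\beta}4\\ 0&0&0&0\end{pmatrix},\qquad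 \mathfrak m=\mathfrak h+\mathbb C X_4 .$$ **Proposition.** 1. The Chevalley–Jordan decomposition of $X=X(x_1,x_2,x_3)\in\mathfrak h$ is unique and has semisimple part $(x_1+x_2)X_4$ and nilpotent part $X-(x_1+x_2)X_4$. 2. The sum $\mathfrak m=\mathfrak h\oplus\mathbb C X_4$ is direct, and $\mathfrak m$ is a $4$-dimensional Lie subalgebra of $gl(4,\mathbb C)$. 3. $\mathfrak m$ is algebraic. 4. $\mathfrak m=\mathfrak n_1\oplus\mathfrak a_1$, where the set $\mathfrak n_1$ of nilpotent elements of $\mathfrak m$ is a $3$-dimensional ideal of $\mathfrak m$, and the set $\mathfrak a_1$ of semisimple elements of $\mathfrak m$ is the Lie subalgebra $\mathbb C X_4$, which is central in $\mathfrak m$. 5. $\mathfrak m$ is the smallest algebraic Lie subalgebra of $gl(4,\mathbb C)$ containing $\mathfrak h$: every algebraic Lie subalgebra of $gl(4,\mathbb C)$ that contains $\mathfrak h$ contains $\mathfrak m$. -/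

import Mathlib

attribute [local instance 100] LieRing.ofAssociativeRing

namespace AlgebraicLie

open Matrix

/-- The point of affine `n × n`-space given by a matrix. -/
noncomputable def point {n : ℕ} (X : Matrix (Fin n) (Fin n) ℂ) : Fin n × Fin n → ℂ :=
  fun ij => X ij.1 ij.2

/-- A subgroup of `GL(n, ℂ)` is an algebraic group if it is the set of common zeros in `GL(n, ℂ)`
of a set of polynomials in the matrix entries. -/
def IsAlgebraicGroup {n : ℕ} (G : Subgroup (GL (Fin n) ℂ)) : Prop :=
  ∃ S : Set (MvPolynomial (Fin n × Fin n) ℂ),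
    ∀ g : GL (Fin n) ℂ,
      g ∈ G ↔ ∀ P ∈ S, MvPolynomial.eval (point (g : Matrix (Fin n) (Fin n) ℂ)) P = 0

/-- The ideal `I(G)` of all polynomials in the matrix entries that vanish on `G`. -/
noncomputable def groupIdeal {n : ℕ} (G : Subgroup (GL (Fin n) ℂ)) :
    Ideal (MvPolynomial (Fin n × Fin n) ℂ) :=
  MvPolynomial.vanishingIdeal ℂ
    ((fun g : GL (Fin n) ℂ => point (g : Matrix (Fin n) (Fin n) ℂ)) '' (G : Set (GL (Fin n) ℂ)))

/-- The differential `dP` at the identity matrix, evaluated at `X`. -/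
noncomputable def differentialAtOne {n : ℕ} (P : MvPolynomial (Fin n × Fin n) ℂ)
    (X : Matrix (Fin n) (Fin n) ℂ) : ℂ :=
  ∑ i, ∑ j, MvPolynomial.eval (point (1 : Matrix (Fin n) (Fin n) ℂ))
    (MvPolynomial.pderiv (i, j) P) * X i j

/-- A Lie subalgebra of `gl(n, ℂ)` is algebraic if it is the Lie algebra of an algebraic group `G`,
that is, if it consists of the matrices `X` with `dP(X) = 0` for all `P` in `I(G)`. -/
def IsAlgebraic {n : ℕ} (L : LieSubalgebra ℂ (Matrix (Fin n) (Fin n) ℂ)) : Prop :=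
  ∃ G : Subgroup (GL (Fin n) ℂ), IsAlgebraicGroup G ∧
    ∀ X : Matrix (Fin n) (Fin n) ℂ, X ∈ L ↔ ∀ P ∈ groupIdeal G, differentialAtOne P X = 0

/-- A matrix is semisimple if the endomorphism it defines is (over `ℂ`: diagonalizable). -/
def IsSemisimple {n : ℕ} (X : Matrix (Fin n) (Fin n) ℂ) : Prop :=
  Module.End.IsSemisimple (Matrix.toLin' X)

/-- `X = S + N` is the Chevalley-Jordan decomposition of `X`. -/
def IsJordanDecomposition {n : ℕ} (X S N : Matrix (Fin n) (Fin n) ℂ) : Prop :=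
  X = S + N ∧ IsSemisimple S ∧ IsNilpotent N ∧ Commute S N

/-- The general element of `h`. -/
noncomputable def hMat (α β x₁ x₂ x₃ : ℂ) : Matrix (Fin 4) (Fin 4) ℂ :=
  !![x₁ + x₂, x₁ + x₂, 0, x₁;
     x₁ + x₂, x₁ + x₂, 0, x₂;
     α * x₁ + (β - 1) * x₂, β * x₁ + (α + 1) * x₂, 0, x₃;
     0, 0, 0, 0]

/-- The matrix `X₄`. -/
noncomputable def X₄ (α β : ℂ) : Matrix (Fin 4) (Fin 4) ℂ :=
  !![1, 1, 0, 1 / 2;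
     1, 1, 0, 1 / 2;
     (α + β) / 2, (α + β) / 2, 0, (α + β) / 4;
     0, 0, 0, 0]

theorem hMat_lie (α β x₁ x₂ x₃ y₁ y₂ y₃ : ℂ) :
    ⁅hMat α β x₁ x₂ x₃, hMat α β y₁ y₂ y₃⁆ = hMat α β 0 0 (x₁ * y₂ - x₂ * y₁) := by
  rw [Ring.lie_def]
  ext i j
  fin_cases i <;> fin_cases j <;>
    simp [hMat] <;> ring

theorem hMat_lie_X₄ (α β x₁ x₂ x₃ : ℂ) : ⁅hMat α β x₁ x₂ x₃, X₄ α β⁆ = 0 := by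
  rw [Ring.lie_def]
  ext i j
  fin_cases i <;> fin_cases j <;>
    simp [hMat, X₄] <;> ring

/-- The Lie subalgebra `h` of `gl(4, ℂ)`. -/
noncomputable def h (α β : ℂ) : LieSubalgebra ℂ (Matrix (Fin 4) (Fin 4) ℂ) where
  carrier := {X | ∃ x₁ x₂ x₃ : ℂ, X = hMat α β x₁ x₂ x₃}
  zero_mem' := ⟨0, 0, 0, by
    ext i j; fin_cases i <;> fin_cases j <;> simp [hMat]⟩
  add_mem' := by
    rintro _ _ ⟨x₁, x₂, x₃, rfl⟩ ⟨y₁, y₂, y₃, rfl⟩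
    refine ⟨x₁ + y₁, x₂ + y₂, x₃ + y₃, ?_⟩
    ext i j; fin_cases i <;> fin_cases j <;> simp [hMat] <;> ring
  smul_mem' := by
    rintro c _ ⟨x₁, x₂, x₃, rfl⟩
    refine ⟨c * x₁, c * x₂, c * x₃, ?_⟩
    ext i j; fin_cases i <;> fin_cases j <;> simp [hMat] <;> ring
  lie_mem' := by
    rintro _ _ ⟨x₁, x₂, x₃, rfl⟩ ⟨y₁, y₂, y₃, rfl⟩
    exact ⟨_, _, _, hMat_lie α β x₁ x₂ x₃ y₁ y₂ y₃⟩

/-- The Lie subalgebra `m = h + ℂ X₄` of `gl(4, ℂ)`. -/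
noncomputable def m (α β : ℂ) : LieSubalgebra ℂ (Matrix (Fin 4) (Fin 4) ℂ) :=
  { (h α β).toSubmodule ⊔ Submodule.span ℂ {X₄ α β} with
    lie_mem' := by
      intro X Y hX hY
      obtain ⟨_, ⟨x₁, x₂, x₃, rfl⟩, _, hS, rfl⟩ := Submodule.mem_sup.1 hX
      obtain ⟨_, ⟨y₁, y₂, y₃, rfl⟩, _, hT, rfl⟩ := Submodule.mem_sup.1 hY
      obtain ⟨c, rfl⟩ := Submodule.mem_span_singleton.1 hS
      obtain ⟨d, rfl⟩ := Submodule.mem_span_singleton.1 hT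
      have e : ⁅X₄ α β, hMat α β y₁ y₂ y₃⁆ = 0 := by
        rw [← lie_skew, hMat_lie_X₄, neg_zero]
      refine Submodule.mem_sup_left ⟨0, 0, x₁ * y₂ - x₂ * y₁, ?_⟩
      simp [hMat_lie, hMat_lie_X₄, e] }

end AlgebraicLie

/-!
Let `G` be an algebraic group. Differentiating the left translates of the polynomials in `I(G)`
shows that its Lie algebra consists of the matrices `A` whose left-invariant derivation `D_A` of the
coordinate ring preserves `I(G)`. If `A = S + N` is the Chevalley-Jordan decomposition, then
`D_A = D_S + D_N`, where `D_S` is diagonalizable, `D_N` is locally nilpotent, and the two commute;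
hence a subspace stable under `D_A` is stable under `D_S`. So an algebraic Lie algebra contains the
semisimple parts of its elements, and one that contains `h` contains `X₄`.

Conversely, `m` is closed under matrix multiplication, so the invertible matrices in `1 + m` form a
group; it is cut out by affine equations, and its Lie algebra is `m`.
-/

namespace AlgebraicLie

open Matrix MvPolynomial

section InvariantSubspaces

variable {K V : Type*} [Field K] [AddCommGroup V] [Module K V]

theorem exists_forall_X_sub_C_pow_dvd_sub_C (t : Finset K) (k : K → ℕ) :
    ∃ q : Polynomial K,
      ∀ a ∈ t, (Polynomial.X - Polynomial.C a) ^ k a ∣ q - Polynomial.C a := by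
  have coprime : Pairwise fun a b : t =>
      IsCoprime (Ideal.span {(Polynomial.X - Polynomial.C (a : K)) ^ k a})
        (Ideal.span {(Polynomial.X - Polynomial.C (b : K)) ^ k b}) := fun a b hab =>
    (Ideal.isCoprime_span_singleton_iff _ _).2 <| IsCoprime.pow <|
      Polynomial.isCoprime_X_sub_C_of_isUnit_sub (sub_ne_zero.2 (Subtype.coe_ne_coe.2 hab)).isUnit
  obtain ⟨q, hq⟩ := Ideal.exists_forall_sub_mem_ideal coprime fun a => Polynomial.C (a : K)
  exact ⟨q, fun a ha => Ideal.mem_span_singleton.1 (hq ⟨a, ha⟩)⟩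

theorem pow_add_sub_algebraMap_apply {s n : Module.End K V} (hsn : Commute s n) {a : K} {v : V}
    (hv : v ∈ s.eigenspace a) (j : ℕ) :
    ((s + n - algebraMap K (Module.End K V) a) ^ j) v = (n ^ j) v := by
  induction j with
  | zero => rfl
  | succ j ih =>
    have eigen : s ((n ^ j) v) = a • (n ^ j) v := by
      rw [← Module.End.mul_apply, (hsn.pow_right j).eq, Module.End.mul_apply,
        Module.End.mem_eigenspace_iff.1 hv, map_smul]
    rw [pow_succ', Module.End.mul_apply, ih, pow_succ', Module.End.mul_apply]
    simp [eigen, Module.algebraMap_end_apply]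

/- On the finitely many eigenspaces of `s` met by `v`, a polynomial congruent to `a` modulo
a high power of `X - a` for each of the eigenvalues `a` takes `s + n` to `s`. -/
theorem mem_invtSubmodule_of_mem_invtSubmodule_add {s n : Module.End K V} (hsn : Commute s n)
    (hs : ⨆ a, s.eigenspace a = ⊤) (hn : ∀ v, ∃ k : ℕ, (n ^ k) v = 0) {p : Submodule K V}
    (hp : p ∈ (s + n).invtSubmodule) : p ∈ s.invtSubmodule := by
  intro v hv
  obtain ⟨w, hw, rfl⟩ :=
    (Submodule.mem_iSup_iff_exists_finsupp _ v).1 (hs ▸ Submodule.mem_top)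
  choose k hk using fun a => hn (w a)
  obtain ⟨q, hq⟩ := exists_forall_X_sub_C_pow_dvd_sub_C w.support k
  have aeval_apply : ∀ a ∈ w.support, Polynomial.aeval (s + n) q (w a) = s (w a) := by
    intro a ha
    obtain ⟨r, hr⟩ := hq a ha
    have : Polynomial.aeval (s + n) (q - Polynomial.C a) (w a) = 0 := by
      rw [hr, mul_comm, map_mul, Module.End.mul_apply, map_pow, map_sub, Polynomial.aeval_X,
        Polynomial.aeval_C, pow_add_sub_algebraMap_apply hsn (hw a), hk, map_zero]
    rw [map_sub, Polynomial.aeval_C, LinearMap.sub_apply, Module.algebraMap_end_apply,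
      sub_eq_zero] at this
    rw [this, Module.End.mem_eigenspace_iff.1 (hw a)]
  have aeval_sum : Polynomial.aeval (s + n) q (w.sum fun _ x => x) = s (w.sum fun _ x => x) := by
    simpa only [Finsupp.sum, map_sum] using Finset.sum_congr rfl aeval_apply
  rw [Submodule.mem_comap, ← aeval_sum]
  exact Polynomial.aeval_apply_smul_mem_of_le_comap hv q _ hp

end InvariantSubspaces

section Derivations

variable {R A σ : Type*} [CommRing R] [CommRing A] [Algebra R A]

theorem derivation_pow_add_apply_mul_eq_zero (D : Derivation R A A) {i j : ℕ} {a b : A}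
    (ha : ((D : Module.End R A) ^ i) a = 0) (hb : ((D : Module.End R A) ^ j) b = 0) :
    ((D : Module.End R A) ^ (i + j)) (a * b) = 0 := by
  induction hN : i + j generalizing i j a b with
  | zero =>
    obtain rfl : i = 0 := by lia
    obtain rfl : a = 0 := ha
    rw [zero_mul, map_zero]
  | succ N ih =>
    rcases i with _ | i
    · obtain rfl : a = 0 := ha
      rw [zero_mul, map_zero]
    rcases j with _ | j
    · obtain rfl : b = 0 := hb
      rw [mul_zero, map_zero]
    have leibniz : (D : Module.End R A) (a * b) =
        a * (D : Module.End R A) b + (D : Module.End R A) a * b := by simp [mul_comm]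
    have left_zero := ih (i := i + 1) ha (by rwa [pow_succ, Module.End.mul_apply] at hb) (by lia)
    have right_zero := ih (i := i) (by rwa [pow_succ, Module.End.mul_apply] at ha) hb (by lia)
    rw [pow_succ, Module.End.mul_apply, leibniz, map_add, left_zero, right_zero, add_zero]

theorem derivation_mul_mem_eigenspace (D : Derivation R A A) {c d : R} {a b : A}
    (ha : a ∈ Module.End.eigenspace (D : Module.End R A) c)
    (hb : b ∈ Module.End.eigenspace (D : Module.End R A) d) :
    a * b ∈ Module.End.eigenspace (D : Module.End R A) (c + d) := by
  rw [Module.End.mem_eigenspace_iff, Derivation.coeFn_coe] at *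
  rw [D.leibniz, ha, hb, add_smul, smul_eq_mul, smul_eq_mul, mul_smul_comm, mul_smul_comm,
    mul_comm b, add_comm]

theorem derivation_mul_mem_iSup_eigenspace (D : Derivation R A A) {a b : A}
    (ha : a ∈ ⨆ c, Module.End.eigenspace (D : Module.End R A) c)
    (hb : b ∈ ⨆ c, Module.End.eigenspace (D : Module.End R A) c) :
    a * b ∈ ⨆ c, Module.End.eigenspace (D : Module.End R A) c := by
  refine Submodule.mul_le.1 ?_ a ha b hb
  rw [Submodule.iSup_mul]
  refine iSup_le fun c => ?_
  rw [Submodule.mul_iSup]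
  exact iSup_le fun d => Submodule.mul_le.2 fun x hx y hy =>
    Submodule.mem_iSup_of_mem (c + d) (derivation_mul_mem_eigenspace D hx hy)

variable (D : Derivation R (MvPolynomial σ R) (MvPolynomial σ R))

theorem exists_derivation_pow_apply_eq_zero
    (hX : ∀ i, ∃ k : ℕ, ((D : Module.End R (MvPolynomial σ R)) ^ k) (X i) = 0)
    (P : MvPolynomial σ R) : ∃ k : ℕ, ((D : Module.End R (MvPolynomial σ R)) ^ k) P = 0 := by
  induction P using MvPolynomial.induction_on with
  | C a => exact ⟨1, by simp⟩
  | add P Q hP hQ =>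
    obtain ⟨⟨i, hi⟩, j, hj⟩ := hP, hQ
    refine ⟨max i j, ?_⟩
    rw [map_add, Module.End.pow_map_zero_of_le (le_max_left i j) hi,
      Module.End.pow_map_zero_of_le (le_max_right i j) hj, add_zero]
  | mul_X P i hP =>
    obtain ⟨⟨j, hj⟩, k, hk⟩ := hP, hX i
    exact ⟨j + k, derivation_pow_add_apply_mul_eq_zero D hj hk⟩

theorem iSup_eigenspace_derivation_eq_top
    (hX : ∀ i, X i ∈ ⨆ c, Module.End.eigenspace (D : Module.End R (MvPolynomial σ R)) c) :
    ⨆ c, Module.End.eigenspace (D : Module.End R (MvPolynomial σ R)) c = ⊤ := by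
  refine eq_top_iff.2 fun P _ => ?_
  induction P using MvPolynomial.induction_on with
  | C a => exact Submodule.mem_iSup_of_mem 0 (by simp)
  | add P Q hP hQ => exact Submodule.add_mem _ (hP trivial) (hQ trivial)
  | mul_X P i hP => exact derivation_mul_mem_iSup_eigenspace D (hP trivial) (hX i)

theorem derivation_apply_eq_sum_pderiv [Fintype σ] (P : MvPolynomial σ R) :
    D P = ∑ i, pderiv i P * D (X i) := by
  classical
  induction P using MvPolynomial.induction_on with
  | C a => simp
  | add P Q hP hQ => simp [hP, hQ, add_mul, Finset.sum_add_distrib]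
  | mul_X P j hP =>
    simp [hP, pderiv_X, Pi.single_apply, add_mul, Finset.sum_add_distrib, Finset.mul_sum,
      mul_assoc]

theorem hasDerivAt_eval {𝕜 : Type*} [NontriviallyNormedField 𝕜]
    (D : Derivation 𝕜 (MvPolynomial σ 𝕜) (MvPolynomial σ 𝕜)) {c : 𝕜 → σ → 𝕜} {t : 𝕜}
    (hc : ∀ i, HasDerivAt (fun u => c u i) (eval (c t) (D (X i))) t) (P : MvPolynomial σ 𝕜) :
    HasDerivAt (fun u => eval (c u) P) (eval (c t) (D P)) t := by
  induction P using MvPolynomial.induction_on with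
  | C a => simpa using hasDerivAt_const t a
  | add P Q hP hQ => simpa using hP.fun_add hQ
  | mul_X P i hP =>
    rw [D.leibniz, map_add, smul_eq_mul, smul_eq_mul, map_mul, map_mul, add_comm,
      mul_comm (eval (c t) (X i))]
    simpa only [map_mul, eval_X] using hP.fun_mul (hc i)

end Derivations

section LeftInvariantDerivations

variable {ι R : Type*} [Fintype ι] [CommRing R]

/-- The linear combination `∑ k, v k * X (i, k)` of the coordinates in row `i` of a matrix. -/
noncomputable def rowForm (i : ι) : (ι → R) →ₗ[R] MvPolynomial (ι × ι) R :=
  Fintype.linearCombination R fun k => X (i, k)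

theorem rowForm_single [DecidableEq ι] (i j : ι) : rowForm i (Pi.single j (1 : R)) = X (i, j) := by
  simp [rowForm, Fintype.linearCombination_apply_single]

/-- The left-invariant derivation of the coordinate ring of `ι × ι`-matrices given by `A`, that is,
the derivative in the direction `g * A` at each point `g`. -/
noncomputable def leftInvDerivation (A : Matrix ι ι R) :
    Derivation R (MvPolynomial (ι × ι) R) (MvPolynomial (ι × ι) R) :=
  mkDerivation R fun ij => rowForm ij.1 (A.col ij.2)

theorem leftInvDerivation_X (A : Matrix ι ι R) (i j : ι) :
    leftInvDerivation A (X (i, j)) = rowForm i (A.col j) :=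
  mkDerivation_X _ _ _

theorem leftInvDerivation_rowForm (A : Matrix ι ι R) (i : ι) (v : ι → R) :
    leftInvDerivation A (rowForm i v) = rowForm i (A *ᵥ v) := by
  have expand : rowForm i v = ∑ k, v k • X (R := R) (i, k) := Fintype.linearCombination_apply ..
  simp only [expand, map_sum, Derivation.map_smul, leftInvDerivation_X, mulVec_eq_sum,
    op_smul_eq_smul, map_smul]
  rfl

theorem leftInvDerivation_add (A B : Matrix ι ι R) :
    leftInvDerivation (A + B) = leftInvDerivation A + leftInvDerivation B := by
  refine derivation_ext fun ⟨i, j⟩ => ?_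
  rw [Derivation.add_apply, leftInvDerivation_X, leftInvDerivation_X, leftInvDerivation_X,
    ← map_add]
  rfl

theorem leftInvDerivation_lie (A B : Matrix ι ι R) :
    ⁅leftInvDerivation A, leftInvDerivation B⁆ = leftInvDerivation ⁅A, B⁆ := by
  refine derivation_ext fun ⟨i, j⟩ => ?_
  rw [Derivation.commutator_apply, leftInvDerivation_X, leftInvDerivation_X, leftInvDerivation_X,
    leftInvDerivation_rowForm, leftInvDerivation_rowForm, ← map_sub, Ring.lie_def]
  rfl

theorem commute_leftInvDerivation {A B : Matrix ι ι R} (hAB : Commute A B) :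
    Commute (leftInvDerivation A : Module.End R (MvPolynomial (ι × ι) R))
      (leftInvDerivation B : Module.End R (MvPolynomial (ι × ι) R)) := by
  have : leftInvDerivation (0 : Matrix ι ι R) = 0 := by
    simpa using leftInvDerivation_add (0 : Matrix ι ι R) 0
  rw [commute_iff_lie_eq, ← Derivation.commutator_coe_linear_map, leftInvDerivation_lie,
    hAB.lie_eq, this, Derivation.coe_zero_linearMap]

variable [DecidableEq ι]

theorem leftInvDerivation_pow_rowForm (A : Matrix ι ι R) (i : ι) (v : ι → R) (k : ℕ) :
    ((leftInvDerivation A : Module.End R (MvPolynomial (ι × ι) R)) ^ k) (rowForm i v) =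
      rowForm i ((A ^ k) *ᵥ v) := by
  induction k with
  | zero => simp
  | succ k ih =>
    rw [pow_succ', Module.End.mul_apply, ih, Derivation.coeFn_coe, leftInvDerivation_rowForm,
      mulVec_mulVec, pow_succ']

theorem exists_leftInvDerivation_pow_apply_eq_zero {N : Matrix ι ι R} (hN : IsNilpotent N)
    (P : MvPolynomial (ι × ι) R) :
    ∃ k : ℕ, ((leftInvDerivation N : Module.End R (MvPolynomial (ι × ι) R)) ^ k) P = 0 := by
  obtain ⟨k, hk⟩ := hN
  refine exists_derivation_pow_apply_eq_zero _ (fun ⟨i, j⟩ => ⟨k, ?_⟩) P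
  rw [← rowForm_single, leftInvDerivation_pow_rowForm, hk, zero_mulVec, map_zero]

theorem iSup_eigenspace_leftInvDerivation_eq_top {S : Matrix ι ι R}
    (hS : ⨆ c, Module.End.eigenspace (toLin' S) c = ⊤) :
    ⨆ c, Module.End.eigenspace
      (leftInvDerivation S : Module.End R (MvPolynomial (ι × ι) R)) c = ⊤ := by
  refine iSup_eigenspace_derivation_eq_top _ fun ⟨i, j⟩ => ?_
  have map_rowForm : (⨆ c, Module.End.eigenspace (toLin' S) c).map (rowForm i) ≤
      ⨆ c, Module.End.eigenspace
        (leftInvDerivation S : Module.End R (MvPolynomial (ι × ι) R)) c := by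
    rw [Submodule.map_iSup]
    refine iSup_mono fun c => Submodule.map_le_iff_le_comap.2 fun v hv => ?_
    rw [Module.End.mem_eigenspace_iff, toLin'_apply] at hv
    rw [Submodule.mem_comap, Module.End.mem_eigenspace_iff, Derivation.coeFn_coe,
      leftInvDerivation_rowForm, hv, map_smul]
  rw [← rowForm_single]
  exact map_rowForm (Submodule.mem_map_of_mem (hS ▸ Submodule.mem_top))

end LeftInvariantDerivations

section LieAlgebra

variable {n : ℕ}

theorem differentialAtOne_eq_eval_leftInvDerivation (P : MvPolynomial (Fin n × Fin n) ℂ)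
    (A : Matrix (Fin n) (Fin n) ℂ) :
    differentialAtOne P A = eval (point 1) (leftInvDerivation A P) := by
  have eval_X_one (i j : Fin n) : eval (point 1) (leftInvDerivation A (X (i, j))) = A i j := by
    simp [leftInvDerivation_X, rowForm, Fintype.linearCombination_apply, point, one_apply,
      smul_eval]
  rw [derivation_apply_eq_sum_pderiv, Fintype.sum_prod_type]
  simp only [differentialAtOne, map_sum, map_mul, eval_X_one]

theorem hasDerivAt_eval_point_mul_one_add_smul (g A : Matrix (Fin n) (Fin n) ℂ)
    (P : MvPolynomial (Fin n × Fin n) ℂ) :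
    HasDerivAt (fun t : ℂ => eval (point (g * (1 + t • A))) P)
      (eval (point g) (leftInvDerivation A P)) 0 := by
  have entries (ij : Fin n × Fin n) :
      HasDerivAt (fun t : ℂ => point (g * (1 + t • A)) ij)
        (eval (point (g * (1 + (0 : ℂ) • A))) (leftInvDerivation A (X ij))) 0 := by
    obtain ⟨i, j⟩ := ij
    have velocity : eval (point (g * (1 + (0 : ℂ) • A))) (leftInvDerivation A (X (i, j))) =
        (g * A) i j := by
      simp [leftInvDerivation_X, rowForm, Fintype.linearCombination_apply, point, smul_eval,
        mul_apply, mul_comm]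
    rw [velocity]
    simpa [point, mul_add] using
      ((hasDerivAt_id (0 : ℂ)).mul_const ((g * A) i j)).const_add (g i j)
  simpa using hasDerivAt_eval (leftInvDerivation A) entries P

theorem hasDerivAt_eval_point_one_add_smul (P : MvPolynomial (Fin n × Fin n) ℂ)
    (A : Matrix (Fin n) (Fin n) ℂ) :
    HasDerivAt (fun t : ℂ => eval (point (1 + t • A)) P) (differentialAtOne P A) 0 := by
  simpa [differentialAtOne_eq_eval_leftInvDerivation] using
    hasDerivAt_eval_point_mul_one_add_smul 1 A P

/-- The left translate `x ↦ P (g * x)` of a polynomial function `P` by a matrix `g`. -/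
noncomputable def leftTranslate (g : Matrix (Fin n) (Fin n) ℂ) :
    MvPolynomial (Fin n × Fin n) ℂ →ₐ[ℂ] MvPolynomial (Fin n × Fin n) ℂ :=
  aeval fun ij => ∑ k, C (g ij.1 k) * X (k, ij.2)

theorem eval_point_leftTranslate (g x : Matrix (Fin n) (Fin n) ℂ)
    (P : MvPolynomial (Fin n × Fin n) ℂ) :
    eval (point x) (leftTranslate g P) = eval (point (g * x)) P := by
  induction P using MvPolynomial.induction_on with
  | C a => simp [leftTranslate]
  | add P Q hP hQ => simp [hP, hQ]
  | mul_X P ij hP =>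
    rw [map_mul, map_mul, map_mul, hP]
    simp [leftTranslate, point, mul_apply]

theorem differentialAtOne_leftTranslate (g A : Matrix (Fin n) (Fin n) ℂ)
    (P : MvPolynomial (Fin n × Fin n) ℂ) :
    differentialAtOne (leftTranslate g P) A = eval (point g) (leftInvDerivation A P) := by
  have := hasDerivAt_eval_point_one_add_smul (leftTranslate g P) A
  simp only [eval_point_leftTranslate] at this
  exact this.unique (hasDerivAt_eval_point_mul_one_add_smul g A P)

theorem mem_groupIdeal {G : Subgroup (GL (Fin n) ℂ)} {P : MvPolynomial (Fin n × Fin n) ℂ} :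
    P ∈ groupIdeal G ↔ ∀ g ∈ G, eval (point (g : Matrix (Fin n) (Fin n) ℂ)) P = 0 := by
  simp [groupIdeal, mem_vanishingIdeal_iff, aeval_eq_eval]

theorem leftTranslate_mem_groupIdeal {G : Subgroup (GL (Fin n) ℂ)} {g : GL (Fin n) ℂ}
    (hg : g ∈ G) {P : MvPolynomial (Fin n × Fin n) ℂ} (hP : P ∈ groupIdeal G) :
    leftTranslate (g : Matrix (Fin n) (Fin n) ℂ) P ∈ groupIdeal G := by
  refine mem_groupIdeal.2 fun x hx => ?_
  rw [eval_point_leftTranslate, ← Units.val_mul]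
  exact mem_groupIdeal.1 hP _ (G.mul_mem hg hx)

theorem forall_differentialAtOne_eq_zero_iff {G : Subgroup (GL (Fin n) ℂ)}
    {A : Matrix (Fin n) (Fin n) ℂ} :
    (∀ P ∈ groupIdeal G, differentialAtOne P A = 0) ↔
      (groupIdeal G).restrictScalars ℂ ∈ Module.End.invtSubmodule
        (leftInvDerivation A : Module.End ℂ (MvPolynomial (Fin n × Fin n) ℂ)) := by
  refine ⟨fun hA P hP => mem_groupIdeal.2 fun g hg => ?_, fun hA P hP => ?_⟩
  · rw [Derivation.coeFn_coe, ← differentialAtOne_leftTranslate]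
    exact hA _ (leftTranslate_mem_groupIdeal hg hP)
  · rw [differentialAtOne_eq_eval_leftInvDerivation]
    exact mem_groupIdeal.1 (hA hP) 1 G.one_mem

theorem IsAlgebraic.semisimple_mem {L : LieSubalgebra ℂ (Matrix (Fin n) (Fin n) ℂ)}
    (hL : IsAlgebraic L) {A S N : Matrix (Fin n) (Fin n) ℂ} (hA : A ∈ L)
    (hASN : IsJordanDecomposition A S N) : S ∈ L := by
  obtain ⟨G, -, hG⟩ := hL
  obtain ⟨rfl, hS, hN, hSN⟩ := hASN
  rw [hG, forall_differentialAtOne_eq_zero_iff] at hA ⊢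
  rw [leftInvDerivation_add, Derivation.coe_add_linearMap] at hA
  exact mem_invtSubmodule_of_mem_invtSubmodule_add (commute_leftInvDerivation hSN)
    (iSup_eigenspace_leftInvDerivation_eq_top hS.iSup_eigenspace_eq_top)
    (exists_leftInvDerivation_pow_apply_eq_zero hN) hA

end LieAlgebra

section MultiplicativelyClosed

/-- The group of units of an algebra lying in `1 + A`, for a finite-dimensional multiplicatively
closed subspace `A`. -/
def unitsOneAdd {K B : Type*} [Field K] [Ring B] [Algebra K B] (A : NonUnitalSubalgebra K B)
    [FiniteDimensional K A.toSubmodule] : Subgroup Bˣ where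
  carrier := {g | (g : B) - 1 ∈ A}
  one_mem' := by simp
  mul_mem' {a b} ha hb := by
    have expand : ((a * b : Bˣ) : B) - 1 =
        ((a : B) - 1) * ((b : B) - 1) + ((a : B) - 1) + ((b : B) - 1) := by
      rw [Units.val_mul]
      noncomm_ring
    rw [Set.mem_ofPred_eq, expand]
    exact add_mem (add_mem (mul_mem ha hb) ha) hb
  inv_mem' {g} hg := by
    have mul_mem_A : ∀ y ∈ A.toSubmodule, LinearMap.mulLeft K (g : B) y ∈ A.toSubmodule := by
      intro y hy
      have expand : (g : B) * y = ((g : B) - 1) * y + y := by noncomm_ring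
      rw [LinearMap.mulLeft_apply, expand]
      exact A.add_mem (A.mul_mem hg hy) hy
    have injective : Function.Injective ((LinearMap.mulLeft K (g : B)).restrict mul_mem_A) :=
      fun y z hyz => Subtype.ext (g.isUnit.mul_left_cancel (congrArg Subtype.val hyz))
    obtain ⟨y, hy⟩ := LinearMap.surjective_of_injective injective ⟨_, neg_mem hg⟩
    have mul_y : (g : B) * y = -((g : B) - 1) := congrArg Subtype.val hy
    have inv_eq : ((g⁻¹ : Bˣ) : B) = 1 + y :=
      Units.inv_eq_of_mul_eq_one_right (by rw [mul_add, mul_y]; noncomm_ring)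
    rw [Set.mem_ofPred_eq, inv_eq, add_sub_cancel_left]
    exact y.2

variable {n : ℕ}

theorem exists_forall_eval_point_eq (f : Module.Dual ℂ (Matrix (Fin n) (Fin n) ℂ)) :
    ∃ P : MvPolynomial (Fin n × Fin n) ℂ, ∀ X, eval (point X) P = f (X - 1) := by
  refine ⟨∑ i, ∑ j, C (f (single i j 1)) * X (i, j) - C (f 1), fun X => ?_⟩
  conv_rhs => rw [map_sub, matrix_eq_sum_single X]
  have (i j : Fin n) : f (single i j (X i j)) = f (single i j 1) * X i j := by
    rw [mul_comm, ← smul_eq_mul, ← map_smul, smul_single, smul_eq_mul, mul_one]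
  simp [this, point]

theorem differentialAtOne_eq_of_eval_point_eq {f : Module.Dual ℂ (Matrix (Fin n) (Fin n) ℂ)}
    {P : MvPolynomial (Fin n × Fin n) ℂ} (hP : ∀ X, eval (point X) P = f (X - 1))
    (A : Matrix (Fin n) (Fin n) ℂ) : differentialAtOne P A = f A := by
  have := hasDerivAt_eval_point_one_add_smul P A
  simp only [hP, add_sub_cancel_left, map_smul] at this
  exact this.unique (by simpa using (hasDerivAt_id (0 : ℂ)).smul_const (f A))

open scoped Topology in
theorem eventually_isUnit_one_add_smul (A : Matrix (Fin n) (Fin n) ℂ) :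
    ∀ᶠ t in 𝓝 (0 : ℂ), IsUnit (1 + t • A) := by
  have continuous_det : Continuous fun t : ℂ => (1 + t • A).det := by fun_prop
  have det_ne_zero : (1 + (0 : ℂ) • A).det ≠ 0 := by simp
  filter_upwards [continuous_det.continuousAt.eventually_ne det_ne_zero] with t ht
  exact (isUnit_iff_isUnit_det _).2 ht.isUnit

theorem differentialAtOne_eq_zero_of_forall_isUnit {P : MvPolynomial (Fin n × Fin n) ℂ}
    {A : Matrix (Fin n) (Fin n) ℂ}
    (hP : ∀ t : ℂ, IsUnit (1 + t • A) → eval (point (1 + t • A)) P = 0) :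
    differentialAtOne P A = 0 := by
  have eventually_zero := (eventually_isUnit_one_add_smul A).mono hP
  exact (hasDerivAt_eval_point_one_add_smul P A).unique
    ((hasDerivAt_const 0 0).congr_of_eventuallyEq eventually_zero)

variable (A : NonUnitalSubalgebra ℂ (Matrix (Fin n) (Fin n) ℂ))

theorem isAlgebraicGroup_unitsOneAdd : IsAlgebraicGroup (unitsOneAdd A) := by
  choose P hP using exists_forall_eval_point_eq (n := n)
  refine ⟨P '' (A.toSubmodule.dualAnnihilator : Set _), fun g => ?_⟩
  rw [Set.forall_mem_image]
  simp only [hP]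
  exact (Subspace.forall_mem_dualAnnihilator_apply_eq_zero_iff A.toSubmodule _).symm

theorem mem_iff_forall_mem_groupIdeal_unitsOneAdd {X : Matrix (Fin n) (Fin n) ℂ} :
    X ∈ A ↔ ∀ P ∈ groupIdeal (unitsOneAdd A), differentialAtOne P X = 0 := by
  refine ⟨fun hX P hP => differentialAtOne_eq_zero_of_forall_isUnit fun t ht => ?_, fun hX => ?_⟩
  · refine mem_groupIdeal.1 hP ht.unit ?_
    change (1 + t • X) - 1 ∈ A
    rw [add_sub_cancel_left]
    exact A.smul_mem t hX
  · refine (Subspace.forall_mem_dualAnnihilator_apply_eq_zero_iff A.toSubmodule X).1 fun f hf => ?_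
    obtain ⟨P, hP⟩ := exists_forall_eval_point_eq f
    rw [← differentialAtOne_eq_of_eval_point_eq hP]
    refine hX P (mem_groupIdeal.2 fun g hg => ?_)
    rw [hP]
    exact (Submodule.mem_dualAnnihilator f).1 hf _ hg

theorem isAlgebraic_of_forall_mul_mem {L : LieSubalgebra ℂ (Matrix (Fin n) (Fin n) ℂ)}
    (hL : ∀ X ∈ L, ∀ Y ∈ L, X * Y ∈ L) : IsAlgebraic L :=
  let A : NonUnitalSubalgebra ℂ (Matrix (Fin n) (Fin n) ℂ) :=
    { L.toSubmodule with mul_mem' := fun hX hY => hL _ hX _ hY }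
  ⟨unitsOneAdd A, isAlgebraicGroup_unitsOneAdd A,
    fun _ => mem_iff_forall_mem_groupIdeal_unitsOneAdd A⟩

end MultiplicativelyClosed

section JordanDecomposition

variable {n : ℕ} {X S N S' N' : Matrix (Fin n) (Fin n) ℂ} {c : ℂ}

theorem IsJordanDecomposition.unique (h : IsJordanDecomposition X S N)
    (h' : IsJordanDecomposition X S' N') : S = S' ∧ N = N' := by
  obtain ⟨hX, hS, hN, hSN⟩ := h
  obtain ⟨hX', hS', hN', hSN'⟩ := h'
  let e := toLinAlgEquiv' (R := ℂ) (n := Fin n)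
  have sum_eq : e N + e S = e N' + e S' := by
    rw [← map_add, ← map_add, add_comm N, add_comm N', ← hX, ← hX']
  obtain ⟨hNN', hSS'⟩ := Module.End.isNilpotent_isSemisimple_unique (hN.map e) hS (hN'.map e) hS'
    (hSN.symm.map e) (hSN'.symm.map e) sum_eq
  exact ⟨e.injective hSS', e.injective hNN'⟩

theorem IsJordanDecomposition.isSemisimple_iff (h : IsJordanDecomposition X S N) :
    IsSemisimple X ↔ N = 0 := by
  refine ⟨fun hX => ?_, fun hN => ?_⟩
  · exact (h.unique ⟨(add_zero X).symm, hX, IsNilpotent.zero, Commute.zero_right X⟩).2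
  · simpa [h.1, hN] using h.2.1

theorem IsJordanDecomposition.isNilpotent_iff (h : IsJordanDecomposition X S N) :
    IsNilpotent X ↔ S = 0 := by
  refine ⟨fun hX => ?_, fun hS => ?_⟩
  · have semisimple_zero : IsSemisimple (0 : Matrix (Fin n) (Fin n) ℂ) := by
      simp [IsSemisimple]
    exact (h.unique ⟨(zero_add X).symm, semisimple_zero, hX, Commute.zero_left X⟩).1
  · simpa [h.1, hS] using h.2.2.1

theorem IsSemisimple.smul (hS : IsSemisimple S) (c : ℂ) : IsSemisimple (c • S) := by
  unfold IsSemisimple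
  rw [map_smul]
  exact Module.End.IsSemisimple_smul c hS

theorem isSemisimple_of_mul_self_eq_smul (hc : c ≠ 0) (hS : S * S = c • S) : IsSemisimple S := by
  have squarefree : Squarefree (Polynomial.X * (Polynomial.X - Polynomial.C c)) := by
    refine squarefree_mul_iff.2 ⟨IsCoprime.isRelPrime ?_, Polynomial.irreducible_X.squarefree,
      (Polynomial.irreducible_X_sub_C c).squarefree⟩
    simpa using Polynomial.isCoprime_X_sub_C_of_isUnit_sub (a := (0 : ℂ)) (b := c)
      (by simpa using hc)
  refine Module.End.isSemisimple_of_squarefree_aeval_eq_zero squarefree ?_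
  have mul_self : toLin' S * toLin' S = c • toLin' S := by
    rw [← map_smul, ← hS, toLin'_mul]
    rfl
  simp [mul_sub, mul_self, Algebra.algebraMap_eq_smul_one]

end JordanDecomposition

section FourByFour

/-- The nilpotent elements of `m α β`, linearly parametrized; they do not depend on `α` and `β`. -/
noncomputable def nilMat : ℂ × ℂ × ℂ →ₗ[ℂ] Matrix (Fin 4) (Fin 4) ℂ where
  toFun v := !![0, 0, 0, v.1;
                0, 0, 0, -v.1;
                v.2.1, -v.2.1, 0, v.2.2;
                0, 0, 0, 0]
  map_add' v w := by
    ext i j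
    fin_cases i <;> fin_cases j <;> simp [add_comm]
  map_smul' c v := by
    ext i j
    fin_cases i <;> fin_cases j <;> simp

theorem nilMat_apply (a b c : ℂ) : nilMat (a, b, c) =
    !![0, 0, 0, a;
       0, 0, 0, -a;
       b, -b, 0, c;
       0, 0, 0, 0] :=
  rfl

theorem nilMat_injective : Function.Injective nilMat := by
  refine (injective_iff_map_eq_zero _).2 fun ⟨a, b, c⟩ hv => ?_
  have ha : a = 0 := congrFun₂ hv 0 3
  have hb : b = 0 := congrFun₂ hv 2 0
  have hc : c = 0 := congrFun₂ hv 2 3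
  rw [ha, hb, hc]
  rfl

theorem nilMat_mul_nilMat (v w : ℂ × ℂ × ℂ) :
    nilMat v * nilMat w = nilMat (0, 0, 2 * v.2.1 * w.1) := by
  obtain ⟨⟨a, b, c⟩, a', b', c'⟩ := v, w
  ext i j
  fin_cases i <;> fin_cases j <;> simp [nilMat_apply, mul_apply, Fin.sum_univ_four]
  ring

theorem nilMat_mul_X₄ (α β : ℂ) (v : ℂ × ℂ × ℂ) : nilMat v * X₄ α β = 0 := by
  obtain ⟨a, b, c⟩ := v
  ext i j
  fin_cases i <;> fin_cases j <;> simp [nilMat_apply, X₄, mul_apply, Fin.sum_univ_four]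

theorem X₄_mul_nilMat (α β : ℂ) (v : ℂ × ℂ × ℂ) : X₄ α β * nilMat v = 0 := by
  obtain ⟨a, b, c⟩ := v
  ext i j
  fin_cases i <;> fin_cases j <;> simp [nilMat_apply, X₄, mul_apply, Fin.sum_univ_four]

theorem X₄_mul_X₄ (α β : ℂ) : X₄ α β * X₄ α β = (2 : ℂ) • X₄ α β := by
  ext i j
  fin_cases i <;> fin_cases j <;> simp [X₄, mul_apply, Fin.sum_univ_four] <;> ring

theorem X₄_ne_zero (α β : ℂ) : X₄ α β ≠ 0 := fun h =>
  one_ne_zero (congrFun₂ h 0 0)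

theorem commute_X₄_nilMat (α β : ℂ) (v : ℂ × ℂ × ℂ) : Commute (X₄ α β) (nilMat v) :=
  (X₄_mul_nilMat α β v).trans (nilMat_mul_X₄ α β v).symm

theorem isNilpotent_nilMat (v : ℂ × ℂ × ℂ) : IsNilpotent (nilMat v) := by
  refine ⟨3, ?_⟩
  rw [pow_three, nilMat_mul_nilMat, nilMat_mul_nilMat, mul_zero]
  exact map_zero nilMat

theorem isJordanDecomposition_smul_X₄_add_nilMat (α β s : ℂ) (v : ℂ × ℂ × ℂ) :
    IsJordanDecomposition (s • X₄ α β + nilMat v) (s • X₄ α β) (nilMat v) :=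
  ⟨rfl, (isSemisimple_of_mul_self_eq_smul two_ne_zero (X₄_mul_X₄ α β)).smul s,
    isNilpotent_nilMat v, (commute_X₄_nilMat α β v).smul_left s⟩

theorem hMat_eq_smul_X₄_add_nilMat (α β x₁ x₂ x₃ : ℂ) :
    hMat α β x₁ x₂ x₃ = (x₁ + x₂) • X₄ α β + nilMat ((x₁ - x₂) / 2,
      (α - β) * ((x₁ - x₂) / 2) - x₂, x₃ - (x₁ + x₂) * (α + β) / 4) := by
  ext i j
  fin_cases i <;> fin_cases j <;> simp [hMat, X₄, nilMat_apply] <;> ring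

theorem nilMat_eq_hMat_sub_smul_X₄ (α β a b c : ℂ) :
    nilMat (a, b, c) = hMat α β ((α - β) * a - b + 2 * a) ((α - β) * a - b)
      (c + ((α - β) * a - b + a) * (α + β) / 2) - (2 * ((α - β) * a - b + a)) • X₄ α β := by
  ext i j
  fin_cases i <;> fin_cases j <;> simp [hMat, X₄, nilMat_apply] <;> ring

theorem isJordanDecomposition_hMat (α β x₁ x₂ x₃ : ℂ) :
    IsJordanDecomposition (hMat α β x₁ x₂ x₃) ((x₁ + x₂) • X₄ α β)
      (hMat α β x₁ x₂ x₃ - (x₁ + x₂) • X₄ α β) := by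
  rw [hMat_eq_smul_X₄_add_nilMat, add_sub_cancel_left]
  exact isJordanDecomposition_smul_X₄_add_nilMat ..

theorem isJordanDecomposition_hMat_iff {α β x₁ x₂ x₃ : ℂ} {S N : Matrix (Fin 4) (Fin 4) ℂ} :
    IsJordanDecomposition (hMat α β x₁ x₂ x₃) S N ↔
      S = (x₁ + x₂) • X₄ α β ∧ N = hMat α β x₁ x₂ x₃ - (x₁ + x₂) • X₄ α β := by
  refine ⟨fun h => h.unique (isJordanDecomposition_hMat ..), ?_⟩
  rintro ⟨rfl, rfl⟩
  exact isJordanDecomposition_hMat ..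

/-- The ideal `n₁` of nilpotent elements of `m α β`. -/
noncomputable def n₁ : LieSubalgebra ℂ (Matrix (Fin 4) (Fin 4) ℂ) :=
  { LinearMap.range nilMat with
    lie_mem' := by
      rintro _ _ ⟨v, rfl⟩ ⟨w, rfl⟩
      rw [Ring.lie_def, nilMat_mul_nilMat, nilMat_mul_nilMat, ← map_sub]
      exact LinearMap.mem_range_self _ _ }

/-- The Lie algebra `a₁ = ℂ X₄` of semisimple elements of `m α β`. -/
noncomputable def a₁ (α β : ℂ) : LieSubalgebra ℂ (Matrix (Fin 4) (Fin 4) ℂ) :=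
  { Submodule.span ℂ {X₄ α β} with
    lie_mem' := by
      intro X Y hX hY
      obtain ⟨c, rfl⟩ := Submodule.mem_span_singleton.1 hX
      obtain ⟨d, rfl⟩ := Submodule.mem_span_singleton.1 hY
      simp }

theorem mem_n₁ {X : Matrix (Fin 4) (Fin 4) ℂ} : X ∈ n₁ ↔ ∃ v, nilMat v = X :=
  Iff.rfl

theorem mem_a₁ {α β : ℂ} {X : Matrix (Fin 4) (Fin 4) ℂ} : X ∈ a₁ α β ↔ ∃ s : ℂ, s • X₄ α β = X :=
  Submodule.mem_span_singleton

theorem finrank_n₁ : Module.finrank ℂ n₁ = 3 :=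
  (LinearMap.finrank_range_of_inj nilMat_injective).trans (by simp)

theorem finrank_a₁ (α β : ℂ) : Module.finrank ℂ (a₁ α β) = 1 :=
  finrank_span_singleton (X₄_ne_zero α β)

variable {α β : ℂ} {X Y : Matrix (Fin 4) (Fin 4) ℂ}

theorem n₁_sup_a₁ (α β : ℂ) : n₁.toSubmodule ⊔ (a₁ α β).toSubmodule = (m α β).toSubmodule := by
  have X₄_mem : X₄ α β ∈ (m α β).toSubmodule :=
    Submodule.mem_sup_right (Submodule.mem_span_singleton_self _)
  have a₁_le : (a₁ α β).toSubmodule ≤ (m α β).toSubmodule :=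
    (Submodule.span_singleton_le_iff_mem _ _).2 X₄_mem
  refine le_antisymm (sup_le ?_ a₁_le) (sup_le ?_ le_sup_right)
  · rintro _ ⟨⟨a, b, c⟩, rfl⟩
    rw [nilMat_eq_hMat_sub_smul_X₄ α β]
    exact sub_mem (Submodule.mem_sup_left ⟨_, _, _, rfl⟩) (Submodule.smul_mem _ _ X₄_mem)
  · rintro _ ⟨x₁, x₂, x₃, rfl⟩
    rw [hMat_eq_smul_X₄_add_nilMat, add_comm]
    exact Submodule.add_mem_sup (mem_n₁.2 ⟨_, rfl⟩) (mem_a₁.2 ⟨_, rfl⟩)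

theorem mem_m_iff : X ∈ m α β ↔ ∃ (s : ℂ) (v : ℂ × ℂ × ℂ), s • X₄ α β + nilMat v = X := by
  rw [← LieSubalgebra.mem_toSubmodule, ← n₁_sup_a₁, sup_comm, Submodule.mem_sup]
  simp [mem_a₁, mem_n₁]

theorem mem_n₁_iff : X ∈ n₁ ↔ X ∈ m α β ∧ IsNilpotent X := by
  rw [mem_n₁, mem_m_iff]
  constructor
  · rintro ⟨v, rfl⟩
    exact ⟨⟨0, v, by rw [zero_smul, zero_add]⟩, isNilpotent_nilMat v⟩
  · rintro ⟨⟨s, v, rfl⟩, hX⟩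
    rw [(isJordanDecomposition_smul_X₄_add_nilMat α β s v).isNilpotent_iff] at hX
    exact ⟨v, by rw [hX, zero_add]⟩

theorem mem_a₁_iff : X ∈ a₁ α β ↔ X ∈ m α β ∧ IsSemisimple X := by
  rw [mem_a₁, mem_m_iff]
  constructor
  · rintro ⟨s, rfl⟩
    exact ⟨⟨s, 0, by rw [map_zero, add_zero]⟩,
      (isJordanDecomposition_smul_X₄_add_nilMat α β s 0).2.1⟩
  · rintro ⟨⟨s, v, rfl⟩, hX⟩
    rw [(isJordanDecomposition_smul_X₄_add_nilMat α β s v).isSemisimple_iff] at hX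
    exact ⟨s, by rw [hX, add_zero]⟩

theorem disjoint_n₁_a₁ (α β : ℂ) : Disjoint n₁.toSubmodule (a₁ α β).toSubmodule := by
  refine Submodule.disjoint_def.2 fun X hX hX' => ?_
  obtain ⟨s, rfl⟩ := mem_a₁.1 hX'
  have decomposition := isJordanDecomposition_smul_X₄_add_nilMat α β s 0
  rw [map_zero, add_zero] at decomposition
  exact decomposition.isNilpotent_iff.1 ((mem_n₁_iff (α := α) (β := β)).1 hX).2

theorem finrank_m (α β : ℂ) : Module.finrank ℂ (m α β) = 4 := by
  have finrank_sup := Submodule.finrank_sup_add_finrank_inf_eq n₁.toSubmodule (a₁ α β).toSubmodule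
  rw [(disjoint_n₁_a₁ α β).eq_bot, n₁_sup_a₁, finrank_bot, add_zero] at finrank_sup
  exact finrank_sup.trans (congrArg₂ (· + ·) finrank_n₁ (finrank_a₁ α β))

theorem disjoint_h_span_X₄ (α β : ℂ) :
    Disjoint (h α β).toSubmodule (Submodule.span ℂ {X₄ α β}) := by
  refine Submodule.disjoint_def.2 fun X hX hX' => ?_
  obtain ⟨x₁, x₂, x₃, rfl⟩ := hX
  have semisimple := (mem_a₁_iff.1 hX').2
  rw [hMat_eq_smul_X₄_add_nilMat,
    (isJordanDecomposition_smul_X₄_add_nilMat ..).isSemisimple_iff,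
    map_eq_zero_iff _ nilMat_injective, Prod.mk_eq_zero, Prod.mk_eq_zero] at semisimple
  obtain ⟨h₁, h₂, h₃⟩ := semisimple
  obtain rfl : x₂ = 0 := by simpa [h₁] using h₂
  obtain rfl : x₁ = 0 := by simpa using h₁
  obtain rfl : x₃ = 0 := by simpa using h₃
  ext i j
  fin_cases i <;> fin_cases j <;> simp [hMat]

theorem m_mul_mem (hX : X ∈ m α β) (hY : Y ∈ m α β) : X * Y ∈ m α β := by
  obtain ⟨s, v, rfl⟩ := mem_m_iff.1 hX
  obtain ⟨t, w, rfl⟩ := mem_m_iff.1 hY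
  refine mem_m_iff.2 ⟨t * (s * 2), (0, 0, 2 * v.2.1 * w.1), ?_⟩
  simp only [add_mul, mul_add, smul_mul_assoc, mul_smul_comm, X₄_mul_X₄,
    X₄_mul_nilMat, nilMat_mul_X₄, nilMat_mul_nilMat, smul_zero, smul_smul, add_zero, zero_add]

theorem isAlgebraic_m (α β : ℂ) : IsAlgebraic (m α β) :=
  isAlgebraic_of_forall_mul_mem fun _ hX _ hY => m_mul_mem hX hY

theorem h_le_m (α β : ℂ) : h α β ≤ m α β := fun _ hX => Submodule.mem_sup_left hX

theorem IsAlgebraic.m_le {L : LieSubalgebra ℂ (Matrix (Fin 4) (Fin 4) ℂ)} (hL : IsAlgebraic L)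
    (hhL : h α β ≤ L) : m α β ≤ L := by
  have X₄_mem : (1 + 0 : ℂ) • X₄ α β ∈ L :=
    hL.semisimple_mem (hhL ⟨1, 0, 0, rfl⟩) (isJordanDecomposition_hMat ..)
  rw [add_zero, one_smul] at X₄_mem
  exact sup_le (c := L.toSubmodule) hhL ((Submodule.span_singleton_le_iff_mem _ _).2 X₄_mem)

theorem lie_eq_zero_of_mem_a₁ (hX : X ∈ m α β) (hY : Y ∈ a₁ α β) : ⁅X, Y⁆ = 0 := by
  obtain ⟨s, v, rfl⟩ := mem_m_iff.1 hX
  obtain ⟨t, rfl⟩ := mem_a₁.1 hY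
  exact ((((Commute.refl (X₄ α β)).smul_left s).add_left
    (commute_X₄_nilMat α β v).symm).smul_right t).lie_eq

theorem lie_mem_n₁ (hX : X ∈ m α β) (hY : Y ∈ n₁) : ⁅X, Y⁆ ∈ n₁ := by
  obtain ⟨s, v, rfl⟩ := mem_m_iff.1 hX
  obtain ⟨w, rfl⟩ := mem_n₁.1 hY
  rw [add_lie, ((commute_X₄_nilMat α β w).smul_left s).lie_eq, zero_add]
  exact n₁.lie_mem (mem_n₁.2 ⟨v, rfl⟩) (mem_n₁.2 ⟨w, rfl⟩)

end FourByFour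

end AlgebraicLie

open AlgebraicLie in
theorem mainTheorem3_general (α β : ℂ) :
    (∀ (x₁ x₂ x₃ : ℂ) (S N : Matrix (Fin 4) (Fin 4) ℂ),
      IsJordanDecomposition (hMat α β x₁ x₂ x₃) S N ↔
        S = (x₁ + x₂) • X₄ α β ∧ N = hMat α β x₁ x₂ x₃ - (x₁ + x₂) • X₄ α β) ∧
    Disjoint (h α β).toSubmodule (Submodule.span ℂ {X₄ α β}) ∧
    (h α β).toSubmodule ⊔ Submodule.span ℂ {X₄ α β} = (m α β).toSubmodule ∧
    Module.finrank ℂ (m α β) = 4 ∧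
    IsAlgebraic (m α β) ∧
    (∃ n₁ a₁ : LieSubalgebra ℂ (Matrix (Fin 4) (Fin 4) ℂ),
      (∀ X, X ∈ n₁ ↔ X ∈ m α β ∧ IsNilpotent X) ∧
      (∀ X, X ∈ a₁ ↔ X ∈ m α β ∧ IsSemisimple X) ∧
      Module.finrank ℂ n₁ = 3 ∧
      a₁.toSubmodule = Submodule.span ℂ {X₄ α β} ∧
      (∀ X ∈ m α β, ∀ Y ∈ n₁, ⁅X, Y⁆ ∈ n₁) ∧
      (∀ X ∈ m α β, ∀ Y ∈ a₁, ⁅X, Y⁆ = 0) ∧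
      Disjoint n₁.toSubmodule a₁.toSubmodule ∧
      n₁.toSubmodule ⊔ a₁.toSubmodule = (m α β).toSubmodule) ∧
    IsLeast {L : LieSubalgebra ℂ (Matrix (Fin 4) (Fin 4) ℂ) | IsAlgebraic L ∧ h α β ≤ L}
      (m α β) := by
  refine ⟨fun x₁ x₂ x₃ S N => isJordanDecomposition_hMat_iff, disjoint_h_span_X₄ α β, rfl,
    finrank_m α β, isAlgebraic_m α β, ⟨n₁, a₁ α β, ?_⟩, ?_⟩
  · exact ⟨fun _ => mem_n₁_iff, fun _ => mem_a₁_iff, finrank_n₁, rfl,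
      fun _ hX _ hY => lie_mem_n₁ hX hY, fun _ hX _ hY => lie_eq_zero_of_mem_a₁ hX hY,
      disjoint_n₁_a₁ α β, n₁_sup_a₁ α β⟩
  · exact ⟨⟨isAlgebraic_m α β, h_le_m α β⟩, fun L hL => hL.1.m_le hL.2⟩

theorem mainTheorem3 (α β : ℂ) (hαβ : α + β ≠ 0) :
    -- the semisimple part of every element of `h` is a multiple of `X₄`
    (∀ (x₁ x₂ x₃ : ℂ) (S N : Matrix (Fin 4) (Fin 4) ℂ),
      AlgebraicLie.IsJordanDecomposition (AlgebraicLie.hMat α β x₁ x₂ x₃) S N ↔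
        S = (x₁ + x₂) • AlgebraicLie.X₄ α β ∧
        N = AlgebraicLie.hMat α β x₁ x₂ x₃ - (x₁ + x₂) • AlgebraicLie.X₄ α β) ∧
    -- `m = h ⊕ ℂ X₄` has dimension 4
    Disjoint (AlgebraicLie.h α β).toSubmodule (Submodule.span ℂ {AlgebraicLie.X₄ α β}) ∧
    (AlgebraicLie.h α β).toSubmodule ⊔ Submodule.span ℂ {AlgebraicLie.X₄ α β} =
      (AlgebraicLie.m α β).toSubmodule ∧
    Module.finrank ℂ (AlgebraicLie.m α β) = 4 ∧
    -- `m` is algebraic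
    AlgebraicLie.IsAlgebraic (AlgebraicLie.m α β) ∧
    -- `m = n₁ ⊕ a₁`
    (∃ n₁ a₁ : LieSubalgebra ℂ (Matrix (Fin 4) (Fin 4) ℂ),
      (∀ X, X ∈ n₁ ↔ X ∈ AlgebraicLie.m α β ∧ IsNilpotent X) ∧
      (∀ X, X ∈ a₁ ↔ X ∈ AlgebraicLie.m α β ∧ AlgebraicLie.IsSemisimple X) ∧
      Module.finrank ℂ n₁ = 3 ∧
      a₁.toSubmodule = Submodule.span ℂ {AlgebraicLie.X₄ α β} ∧
      (∀ X ∈ AlgebraicLie.m α β, ∀ Y ∈ n₁, ⁅X, Y⁆ ∈ n₁) ∧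
      (∀ X ∈ AlgebraicLie.m α β, ∀ Y ∈ a₁, ⁅X, Y⁆ = 0) ∧
      Disjoint n₁.toSubmodule a₁.toSubmodule ∧
      n₁.toSubmodule ⊔ a₁.toSubmodule = (AlgebraicLie.m α β).toSubmodule) ∧
    -- `m` is the smallest algebraic Lie algebra containing `h`
    IsLeast {L : LieSubalgebra ℂ (Matrix (Fin 4) (Fin 4) ℂ) |
      AlgebraicLie.IsAlgebraic L ∧ AlgebraicLie.h α β ≤ L} (AlgebraicLie.m α β) :=
  mainTheorem3_general α β
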